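/- Let $u>0$, $T=[0,u]$, let $\lambda$ be Lebesgue measure (on $T$, and on $\mathbb R$ in the conditions on $\psi$ below), and let $d\in\mathbb N$. For $\alpha\in(0,1)$ let $E_\alpha$ be the space of $\alpha$-Hölder continuous functions $f:T\to\mathbb R^d$ with $f(0)=0$, and put $$\|f\|_\alpha=\sup_{s,t\in T,\ 0<t-s\le 1}\frac{|f(t)-f(s)|}{(t-s)^\alpha}.$$ Let $E_{\alpha,0}$ be the space of those $f\in E_\alpha$ with $|f(t)-f(s)|=o(|t-s|^\alpha)$ as $|t-s|\searrow 0$ (uniformly in $s,t\in T$), and let $C_0^\infty(T;\mathbb R^d)$ be the space of smooth functions $f:T\to\mathbb R^d$ with $f(0)=0$. For $g\in L^2(T,\lambda;\mathbb R^d)$ put $J(g)(t)=\int_{[0,t]}g(s)\,\lambda(\mathrm ds)$, $t\in T$. For $\psi:\mathbb R\to\mathbb R$ let $\mathcal{NN}^d_{1,\infty}(\psi)$ be the set of shallow feedforward networks with activation function $\psi$, that is, of all functions $t\mapsto\sum_{j=1}^N\psi(a_jt+b_j)\,w_j$ with $N\in\mathbb N_0$, $a_j,b_j\in\mathbb R$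 and $w_j\in\mathbb R^d$. Assume that $\psi$ satisfies at least one of the following conditions: 1. $\psi$ is continuous, bounded and non-constant; 2. $\psi$ is locally $\lambda$-essentially bounded, $\psi$ is not $\lambda$-a.e. equal to a polynomial, and the set of points of discontinuity of $\psi$ is a $\lambda$-null set; 3. $\psi$ is bounded, measurable and not $\lambda$-a.e. equal to a constant. Let $0<\beta<\alpha<1/2$. Then for each $f\in E_{\alpha,0}$ there is a sequence $(f_n)_{n\in\mathbb N}$ in $\mathcal{NN}^d_{1,\infty}(\psi)\cap L^2(T,\lambda;\mathbb R^d)$ with $$\lim_{n\to\infty}\|f-J(f_n)\|_\alpha=0.$$ In particular, for each $f\in C_0^\infty(T;\mathbb R^d)$ there is such a sequence with $\|f-J(f_n)\|_\alpha\to0$, and for each $f\in E_\alpha$ there is such a sequence with $\|f-J(f_n)\|_\beta\to 0$. -/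

import Mathlib

open MeasureTheory Filter Topology
open scoped NNReal ENNReal ContDiff

noncomputable section

/-- The time horizon `T = [0, u]`. Functions on `T` are represented by functions on `ℝ`, of which
only the values on `T` matter. -/
abbrev timeSet (u : ℝ) : Set ℝ := Set.Icc 0 u

/-- The Lebesgue measure `λ`, restricted to `T = [0, u]`. -/
abbrev timeMeasure (u : ℝ) : Measure ℝ := volume.restrict (timeSet u)

/-- Membership in `Λ²`, for a measure `μ` and a matrix-valued function `π`:
`∫ f(s)ᵀ π(s) f(s) μ(ds) < ∞`. Elements of `Λ²` are functions up to null sets. -/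
def MemLambda2 {d : ℕ} (μ : Measure ℝ) (π : ℝ → Matrix (Fin d) (Fin d) ℝ)
    (f : ℝ → EuclideanSpace ℝ (Fin d)) : Prop :=
  AEStronglyMeasurable f μ ∧
    ∫⁻ s, ENNReal.ofReal ((f s).ofLp ⬝ᵥ (Matrix.mulVec (π s) (f s).ofLp)) ∂μ < ⊤

/-- The operator `J`: `J f (t) = ∫_{[0,t]} π(s) f(s) μ(ds)`. -/
def cameronMartinMap {d : ℕ} (μ : Measure ℝ) (π : ℝ → Matrix (Fin d) (Fin d) ℝ)
    (f : ℝ → EuclideanSpace ℝ (Fin d)) (t : ℝ) : EuclideanSpace ℝ (Fin d) :=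
  ∫ s in Set.Icc 0 t, WithLp.toLp 2 (Matrix.mulVec (π s) (f s).ofLp) ∂μ

/-- Shallow feedforward networks with one input neuron, one hidden layer with any finite number of
nodes with activation function `ψ`, and `d` output neurons with the identity as activation.
An additional bias `c` in the output layer would give the same functions as soon as `ψ` has a value
`ψ b ≠ 0`, because `c = ψ (0 * t + b) • (ψ b)⁻¹ • c`. -/
def shallowNetworks (d : ℕ) (ψ : ℝ → ℝ) : Set (ℝ → EuclideanSpace ℝ (Fin d)) :=
  {g | ∃ (N : ℕ) (a b : Fin N → ℝ) (w : Fin N → EuclideanSpace ℝ (Fin d)),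
    ∀ t, g t = ∑ j, ψ (a j * t + b j) • w j}

/-- `ψ` is continuous, bounded and non-constant. -/
def ContinuousBoundedNonconstant (ψ : ℝ → ℝ) : Prop :=
  Continuous ψ ∧ (∃ C, ∀ x, |ψ x| ≤ C) ∧ ¬ ∃ c, ∀ x, ψ x = c

/-- `ψ` is locally essentially bounded, not almost everywhere equal to a polynomial, and its points
of discontinuity form a null set. -/
def LocallyBoundedNonpolynomial (ψ : ℝ → ℝ) : Prop :=
  (∀ K : Set ℝ, IsCompact K → ∃ C, ∀ᵐ x ∂(volume.restrict K), |ψ x| ≤ C) ∧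
    (∀ p : Polynomial ℝ, ¬ ∀ᵐ x ∂(volume : Measure ℝ), ψ x = p.eval x) ∧
    volume {x | ¬ ContinuousAt ψ x} = 0

/-- `ψ` is bounded, measurable and not almost everywhere equal to a constant. -/
def MeasurableBoundedNonconstant (ψ : ℝ → ℝ) : Prop :=
  Measurable ψ ∧ (∃ C, ∀ x, |ψ x| ≤ C) ∧
    ¬ ∃ c, ∀ᵐ x ∂(volume : Measure ℝ), ψ x = c

/-- The conditions on the activation function. -/
def AdmissibleActivation (ψ : ℝ → ℝ) : Prop :=
  ContinuousBoundedNonconstant ψ ∨ LocallyBoundedNonpolynomial ψ ∨ MeasurableBoundedNonconstant ψ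

/-- The Hölder norm `‖f‖_α = sup |f(t) - f(s)| / (t - s)^α` over `s, t ∈ [0, u]` with
`0 < t - s ≤ 1`, with values in `[0, ∞]`. -/
def holderENorm {d : ℕ} (u : ℝ) (α : ℝ≥0) (f : ℝ → EuclideanSpace ℝ (Fin d)) : ℝ≥0∞ :=
  ⨆ (s ∈ timeSet u) (t ∈ timeSet u) (_ : 0 < t - s ∧ t - s ≤ 1),
    ENNReal.ofReal (‖f t - f s‖ / (t - s) ^ (α : ℝ))

/-- The Hölder space `E_α` of `α`-Hölder continuous functions on `[0, u]` that vanish at `0`. -/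
def MemHolderSpace {d : ℕ} (u : ℝ) (α : ℝ≥0) (f : ℝ → EuclideanSpace ℝ (Fin d)) : Prop :=
  f 0 = 0 ∧ ∃ C : ℝ≥0, HolderOnWith C α f (timeSet u)

/-- The little Hölder space `E_{α,0}`: all `f ∈ E_α` with `|f(t) - f(s)| = o(|t - s|^α)` as
`|t - s| ↘ 0`, uniformly in `s, t ∈ [0, u]`. -/
def MemLittleHolderSpace {d : ℕ} (u : ℝ) (α : ℝ≥0) (f : ℝ → EuclideanSpace ℝ (Fin d)) : Prop :=
  MemHolderSpace u α f ∧
    ∀ ε > 0, ∃ δ > 0, ∀ s ∈ timeSet u, ∀ t ∈ timeSet u, |t - s| < δ →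
      ‖f t - f s‖ ≤ ε * |t - s| ^ (α : ℝ)

/-- The space `C_0^∞` of smooth functions on `[0, u]` that vanish at `0`. -/
def MemSmoothSpace {d : ℕ} (u : ℝ) (f : ℝ → EuclideanSpace ℝ (Fin d)) : Prop :=
  f 0 = 0 ∧ ContDiffOn ℝ ∞ f (timeSet u)

/-- There is a sequence of shallow networks `g n`, all of them in `Λ²`, such that
`‖f - J (g n)‖_α → 0`, for `μ = λ` and `π = I_d`. -/
def ApproximableByNetworks {d : ℕ} (u : ℝ) (ψ : ℝ → ℝ) (α : ℝ≥0)
    (f : ℝ → EuclideanSpace ℝ (Fin d)) : Prop :=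
  ∃ g : ℕ → ℝ → EuclideanSpace ℝ (Fin d),
    (∀ n, g n ∈ shallowNetworks d ψ ∧ MemLambda2 (timeMeasure u) (fun _ => 1) (g n)) ∧
    Tendsto (fun n => holderENorm u α
      (fun t => f t - cameronMartinMap (timeMeasure u) (fun _ => 1) (g n) t)) atTop (𝓝 0)

end

/-! By Cauchy–Schwarz, increments of `J g` over `[s, t]` are at most `‖g‖₂ (t - s)^(1/2)`, so for `α
< 1/2` the map `J` is bounded from `L²` to the Hölder norm (`enorm_integral_div_rpow_le`). It
remains to approximate `f` by `J G` with `G` continuous, and `G` in `L²` by networks.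

For the former, `G` is a difference quotient of `f`, so that `J G` has the increments of a Steklov
average; the little-o condition makes the error small (`exists_continuous_integral_holder_close`).
Smooth functions and Hölder functions of a larger exponent satisfy this condition.

For the latter, let `h` be orthogonal to all `t ↦ ψ (a * t + b)`. Then it is orthogonal to the same
functions for every mollification `Ψ` of `ψ`, and `k` derivatives in `a` at `a = 0` give `Ψ⁽ᵏ⁾(b) ∫
tᵏ h = 0`. If the `k`-th moment were nonzero, every `Ψ` would be a polynomial of degree less than
`k`, hence so would `ψ` almost everywhere. So all moments vanish, and `h = 0` by Weierstrass. -/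

/-! ### Polynomials of bounded degree and their limits -/

/-- A smooth function with vanishing `k`-th derivative is a polynomial of degree less than `k`. -/
theorem exists_polynomial_of_iteratedDeriv_eq_zero (k : ℕ) (f : ℝ → ℝ) (hf : ContDiff ℝ ∞ f)
    (h : ∀ x, iteratedDeriv k f x = 0) :
    ∃ p : Polynomial ℝ, p.degree < k ∧ ∀ x, f x = p.eval x := by
  rcases k with _ | n
  · exact ⟨0, by simp, by simpa using h⟩
  refine ⟨∑ i ∈ Finset.range (n + 1),
    Polynomial.C (iteratedDeriv i f 0 / i.factorial) * Polynomial.X ^ i, ?_, fun x ↦ ?_⟩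
  · rw [← Polynomial.mem_degreeLT]
    refine Submodule.sum_mem _ fun i hi ↦ ?_
    rw [Polynomial.mem_degreeLT]
    exact (Polynomial.degree_C_mul_X_pow_le _ _).trans_lt
      (by exact_mod_cast Finset.mem_range.1 hi)
  · simp only [Polynomial.eval_finsetSum, Polynomial.eval_mul, Polynomial.eval_C,
      Polynomial.eval_pow, Polynomial.eval_X]
    rcases eq_or_ne 0 x with rfl | hx
    · rw [Finset.sum_eq_single_of_mem 0 (by simp) fun i _ hi ↦ by simp [hi]]
      simp
    · have hfn : ∀ m : ℕ, ContDiff ℝ m f := fun m ↦ hf.of_le (by exact_mod_cast le_top)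
      obtain ⟨y, -, hy⟩ := taylor_mean_remainder_lagrange_iteratedDeriv (f := f) (n := n) hx
        (hfn (n + 1)).contDiffOn
      rw [h, zero_mul, zero_div, sub_eq_zero] at hy
      rw [hy, taylor_within_apply]
      refine Finset.sum_congr rfl fun i _ ↦ ?_
      rw [iteratedDerivWithin_eq_iteratedDeriv (uniqueDiffOn_uIcc hx) (hfn i).contDiffAt
        Set.left_mem_uIcc, smul_eq_mul, sub_zero]
      ring

/-- A locally integrable function all of whose mollifications have vanishing `k`-th derivative is
almost everywhere equal to a polynomial. -/
theorem exists_polynomial_ae_eq_of_iteratedDeriv_convolution_eq_zero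
    (k : ℕ) (ψ : ℝ → ℝ) (hψ : LocallyIntegrable ψ)
    (h : ∀ (φ : ContDiffBump (0 : ℝ)) (x : ℝ),
      iteratedDeriv k (convolution (φ.normed volume) ψ (ContinuousLinearMap.lsmul ℝ ℝ) volume) x
        = 0) :
    ∃ p : Polynomial ℝ, ∀ᵐ x, ψ x = p.eval x := by
  -- The radii shrink with fixed ratio 2, as Lebesgue differentiation along the bumps needs a
  -- bounded ratio.
  let φ : ℕ → ContDiffBump (0 : ℝ) := fun n ↦
    ⟨1 / ((n : ℝ) + 1), 2 * (1 / ((n : ℝ) + 1)), by positivity, by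
      have : 0 < 1 / ((n : ℝ) + 1) := by positivity
      linarith⟩
  have hlim := ContDiffBump.ae_convolution_tendsto_right_of_locallyIntegrable (φ := φ)
    (l := atTop) (K := 2) (μ := volume)
    (by simpa [φ] using (tendsto_one_div_add_atTop_nhds_zero_nat (𝕜 := ℝ)).const_mul 2)
    (Eventually.of_forall fun n ↦ le_rfl) hψ
  choose p hdeg hp using fun n ↦ exists_polynomial_of_iteratedDeriv_eq_zero k _
    ((φ n).hasCompactSupport_normed.contDiff_convolution_left (n := ⊤)
      (ContinuousLinearMap.lsmul ℝ ℝ) (φ n).contDiff_normed hψ) (h (φ n))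
  have hinf : {x | Tendsto (fun n ↦ (convolution ((φ n).normed volume) ψ
      (ContinuousLinearMap.lsmul ℝ ℝ) volume) x) atTop (𝓝 (ψ x))}.Infinite := by
    intro hfin
    have h0 := hfin.measure_zero (volume : Measure ℝ)
    have h1 : volume (Set.univ : Set ℝ) = 0 := by
      rw [← Set.union_compl_self {x | Tendsto (fun n ↦ (convolution ((φ n).normed volume) ψ
        (ContinuousLinearMap.lsmul ℝ ℝ) volume) x) atTop (𝓝 (ψ x))}]
      exact measure_union_null h0 hlim
    simp at h1
  -- Interpolation at `k` fixed nodes where the mollifications converge recovers each of them from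
  -- its node values, so the limit has the same form.
  obtain ⟨s, hs, hcard⟩ := hinf.exists_subset_card_eq k
  refine ⟨Lagrange.interpolate s id ψ, ?_⟩
  filter_upwards [hlim] with x hx
  refine tendsto_nhds_unique hx ?_
  have heq : ∀ n, (convolution ((φ n).normed volume) ψ
      (ContinuousLinearMap.lsmul ℝ ℝ) volume) x = ∑ i ∈ s, (convolution ((φ n).normed volume) ψ
      (ContinuousLinearMap.lsmul ℝ ℝ) volume) i * (Lagrange.basis s id i).eval x := by
    intro n
    rw [hp n x, Lagrange.eq_interpolate (s := s) (v := id) (f := p n) Function.injective_id.injOn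
      (by rw [hcard]; exact hdeg n)]
    simp [Lagrange.interpolate_apply, Polynomial.eval_finsetSum, hp]
  simp_rw [heq]
  simp only [Lagrange.interpolate_apply, Polynomial.eval_finsetSum, Polynomial.eval_mul,
    Polynomial.eval_C]
  exact tendsto_finsetSum _ fun i hi ↦ Tendsto.mul_const _ (hs hi)

/-! ### Moments of a function orthogonal to dilates -/

section Moments

variable {E : Type*} [NormedAddCommGroup E] [NormedSpace ℝ E]

/-- Differentiation in `a` under the integral sign; the chain rule supplies the factor `t`. -/
theorem integral_deriv_smul_eq_zero (u : ℝ) (h : ℝ → E) (hh : IntegrableOn h (Set.Icc 0 u))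
    (Ψ : ℝ → ℝ) (hΨ : ContDiff ℝ 1 Ψ) (b : ℝ)
    (h0 : ∀ a, ∫ t in Set.Icc 0 u, Ψ (a * t + b) • h t = 0) (a : ℝ) :
    ∫ t in Set.Icc 0 u, deriv Ψ (a * t + b) • (t • h t) = 0 := by
  have hc : Continuous (deriv Ψ) := hΨ.continuous_deriv le_rfl
  obtain ⟨M, hM⟩ := ((isCompact_closedBall a 1).prod
    (isCompact_Icc (a := 0) (b := u))).exists_bound_of_continuousOn
    (f := fun q : ℝ × ℝ ↦ deriv Ψ (q.1 * q.2 + b) * q.2) (by fun_prop)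
  have hbdd : ∀ (g : ℝ → ℝ), Continuous g → IntegrableOn (fun t ↦ g t • h t) (Set.Icc 0 u) :=
    fun g hg ↦ hh.continuousOn_smul hg.continuousOn isCompact_Icc
  have key := hasDerivAt_integral_of_dominated_loc_of_deriv_le
    (μ := volume.restrict (Set.Icc 0 u)) (F := fun a t ↦ Ψ (a * t + b) • h t)
    (F' := fun a t ↦ (deriv Ψ (a * t + b) * t) • h t) (x₀ := a) (s := Metric.closedBall a 1)
    (bound := fun t ↦ M * ‖h t‖) (Metric.closedBall_mem_nhds a one_pos)
    (Eventually.of_forall fun x ↦ (hbdd _ (by fun_prop)).aestronglyMeasurable)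
    (hbdd _ (by fun_prop)) (hbdd _ (by fun_prop)).aestronglyMeasurable
    (by
      filter_upwards [ae_restrict_mem measurableSet_Icc] with t ht x hx
      rw [norm_smul]
      exact mul_le_mul_of_nonneg_right (hM (x, t) ⟨hx, ht⟩) (norm_nonneg _))
    (hh.norm.const_mul M)
    (by
      refine Eventually.of_forall fun t x _ ↦ HasDerivAt.smul_const ?_ _
      have h1 : HasDerivAt (fun x : ℝ ↦ x * t + b) t x := by
        simpa using ((hasDerivAt_id x).mul_const t).add_const b
      exact ((hΨ.differentiable one_ne_zero _).hasDerivAt).comp x h1)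
  have h2 := key.2
  simp only [h0] at h2
  simpa [mul_smul] using h2.unique (hasDerivAt_const a 0)

theorem integral_iteratedDeriv_smul_eq_zero (u : ℝ) (h : ℝ → E)
    (hh : IntegrableOn h (Set.Icc 0 u)) (Ψ : ℝ → ℝ) (hΨ : ContDiff ℝ ∞ Ψ) (b : ℝ)
    (h0 : ∀ a, ∫ t in Set.Icc 0 u, Ψ (a * t + b) • h t = 0) (k : ℕ) (a : ℝ) :
    ∫ t in Set.Icc 0 u, iteratedDeriv k Ψ (a * t + b) • (t ^ k • h t) = 0 := by
  induction k generalizing a with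
  | zero => simpa using h0 a
  | succ k ih =>
    have := integral_deriv_smul_eq_zero u (fun t ↦ t ^ k • h t)
      (hh.continuousOn_smul (by fun_prop) isCompact_Icc) (iteratedDeriv k Ψ)
      (by
        rw [iteratedDeriv_eq_iterate]
        exact (ContDiff.iterate_deriv k hΨ).of_le (by exact_mod_cast le_top)) b ih a
    simpa [iteratedDeriv_succ, smul_smul, pow_succ, mul_comm, mul_assoc] using this

/-- An integrable function on an interval with vanishing moments vanishes almost everywhere. -/
theorem ae_eq_zero_of_integral_pow_smul_eq_zero [CompleteSpace E] (u : ℝ) (h : ℝ → E)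
    (hh : IntegrableOn h (Set.Icc 0 u))
    (h0 : ∀ k : ℕ, ∫ t in Set.Icc 0 u, t ^ k • h t = 0) :
    ∀ᵐ t ∂volume.restrict (Set.Icc 0 u), h t = 0 := by
  have hint : ∀ (g : ℝ → ℝ), Continuous g → IntegrableOn (fun t ↦ g t • h t) (Set.Icc 0 u) :=
    fun g hg ↦ hh.continuousOn_smul hg.continuousOn isCompact_Icc
  have hpoly : ∀ p : Polynomial ℝ, ∫ t in Set.Icc 0 u, p.eval t • h t = 0 := by
    intro p
    simp_rw [Polynomial.eval_eq_sum_range, Finset.sum_smul, mul_smul]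
    rw [integral_finsetSum _ fun i _ ↦ by
      exact (hint (fun t ↦ t ^ i) (by fun_prop)).smul (p.coeff i)]
    exact Finset.sum_eq_zero fun i _ ↦ by rw [integral_smul, h0, smul_zero]
  refine ae_eq_zero_of_integral_contDiff_smul_eq_zero
    (Integrable.locallyIntegrable hh) fun g hg _ ↦ ?_
  rw [← norm_le_zero_iff]
  refine le_of_forall_pos_le_add fun ε hε ↦ ?_
  set I := ∫ t in Set.Icc 0 u, ‖h t‖ with hI
  have hI0 : 0 ≤ I := integral_nonneg fun _ ↦ norm_nonneg _
  -- The `+ 1` guards against `I = 0`.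
  obtain ⟨p, hp⟩ := exists_polynomial_near_of_continuousOn 0 u g hg.continuous.continuousOn
    (ε / (I + 1)) (by positivity)
  have : ∫ t in Set.Icc 0 u, g t • h t = ∫ t in Set.Icc 0 u, (g t - p.eval t) • h t := by
    simp_rw [sub_smul]
    rw [integral_sub (hint g hg.continuous) (hint _ p.continuous), hpoly, sub_zero]
  rw [this, zero_add]
  calc _ ≤ ∫ t in Set.Icc 0 u, ε / (I + 1) * ‖h t‖ := by
        refine norm_integral_le_of_norm_le (hh.norm.const_mul _) ?_
        filter_upwards [ae_restrict_mem measurableSet_Icc] with t ht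
        rw [norm_smul]
        refine mul_le_mul_of_nonneg_right ?_ (norm_nonneg _)
        rw [Real.norm_eq_abs, abs_sub_comm]
        exact (hp t ht).le
    _ = ε * (I / (I + 1)) := by rw [integral_const_mul, ← hI]; ring
    _ ≤ ε * 1 := by
        gcongr
        rw [div_le_one (by positivity)]; linarith
    _ = ε := mul_one ε

end Moments

/-! ### Orthogonality to the activations -/

theorem locallyIntegrable_of_locally_ae_bounded {ψ : ℝ → ℝ} (hm : AEStronglyMeasurable ψ volume)
    (hb : ∀ K : Set ℝ, IsCompact K → ∃ C, ∀ᵐ x ∂(volume.restrict K), |ψ x| ≤ C) :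
    LocallyIntegrable ψ := by
  rw [locallyIntegrable_iff]
  intro K hK
  obtain ⟨C, hC⟩ := hb K hK
  exact Measure.integrableOn_of_bounded hK.measure_lt_top.ne hm hC

/-- By Fubini, the convolution averages the hypothesis over the biases `b - y`. -/
theorem integral_convolution_smul_eq_zero {E : Type*} [NormedAddCommGroup E] [NormedSpace ℝ E]
    [CompleteSpace E] {ψ : ℝ → ℝ} (hm : AEStronglyMeasurable ψ volume)
    (hb : ∀ K : Set ℝ, IsCompact K → ∃ C, ∀ᵐ x ∂(volume.restrict K), |ψ x| ≤ C)
    (u : ℝ) (h : ℝ → E) (hh : IntegrableOn h (Set.Icc 0 u))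
    (h0 : ∀ a b, ∫ t in Set.Icc 0 u, ψ (a * t + b) • h t = 0)
    (φ : ℝ → ℝ) (hφ : Continuous φ) (hφc : HasCompactSupport φ) (a b : ℝ) :
    ∫ t in Set.Icc 0 u,
      convolution φ ψ (ContinuousLinearMap.lsmul ℝ ℝ) volume (a * t + b) • h t = 0 := by
  have hq : Measure.QuasiMeasurePreserving (fun q : ℝ × ℝ ↦ a * q.1 + b - q.2)
      ((volume.restrict (Set.Icc 0 u)).prod volume) volume :=
    QuasiMeasurePreserving.prod_of_right (by fun_prop)
      (Eventually.of_forall fun t ↦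
        (Measure.measurePreserving_sub_left volume (a * t + b)).quasiMeasurePreserving)
  -- This compact set contains every argument of `ψ` at which `φ` is nonzero, so one essential bound
  -- `C` suffices.
  have hK : IsCompact ((fun q : ℝ × ℝ ↦ a * q.1 + b - q.2) '' (Set.Icc 0 u ×ˢ tsupport φ)) :=
    (isCompact_Icc.prod hφc).image (by fun_prop)
  obtain ⟨C, hC⟩ := hb _ hK
  rw [ae_restrict_iff' hK.measurableSet] at hC
  have hφi : Integrable φ := hφ.integrable_of_hasCompactSupport hφc
  have hint : Integrable (fun q : ℝ × ℝ ↦ (φ q.2 * ψ (a * q.1 + b - q.2)) • h q.1)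
      ((volume.restrict (Set.Icc 0 u)).prod volume) := by
    refine Integrable.mono' ((hh.norm.mul_prod hφi.norm).const_mul C) ?_ ?_
    · exact ((hφ.comp continuous_snd).aestronglyMeasurable.mul
        (hm.comp_quasiMeasurePreserving hq)).smul hh.aestronglyMeasurable.comp_fst
    · have hmem : ∀ᵐ q : ℝ × ℝ ∂((volume.restrict (Set.Icc 0 u)).prod volume),
          q.1 ∈ Set.Icc 0 u :=
        Measure.quasiMeasurePreserving_fst.ae (ae_restrict_mem measurableSet_Icc)
      filter_upwards [hq.ae hC, hmem] with q h1 h2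
      by_cases hz : φ q.2 = 0
      · simp [hz]
      · have := h1 ⟨q, ⟨h2, subset_tsupport _ hz⟩, rfl⟩
        rw [norm_smul, norm_mul, Real.norm_eq_abs (ψ _)]
        calc _ ≤ ‖φ q.2‖ * C * ‖h q.1‖ := by gcongr
          _ = _ := by ring
  calc _ = ∫ t in Set.Icc 0 u, ∫ y, (φ y * ψ (a * t + b - y)) • h t := by
        simp_rw [convolution_def, ← integral_smul_const]
        rfl
    _ = ∫ y, ∫ t in Set.Icc 0 u, (φ y * ψ (a * t + b - y)) • h t :=
        integral_integral_swap hint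
    _ = ∫ y, (0 : E) := by
        refine integral_congr_ae (Eventually.of_forall fun y ↦ ?_)
        simp_rw [mul_smul, integral_smul, add_sub_assoc]
        rw [h0, smul_zero]
    _ = 0 := integral_zero _ _

/-- A function that is orthogonal on `[0, u]` to all `t ↦ ψ (a * t + b)` vanishes. -/
theorem ae_eq_zero_of_integral_activation_smul_eq_zero {E : Type*} [NormedAddCommGroup E]
    [NormedSpace ℝ E] [CompleteSpace E] {ψ : ℝ → ℝ} (hm : AEStronglyMeasurable ψ volume)
    (hb : ∀ K : Set ℝ, IsCompact K → ∃ C, ∀ᵐ x ∂(volume.restrict K), |ψ x| ≤ C)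
    (hp : ∀ p : Polynomial ℝ, ¬ ∀ᵐ x ∂(volume : Measure ℝ), ψ x = p.eval x)
    (u : ℝ) (h : ℝ → E) (hh : IntegrableOn h (Set.Icc 0 u))
    (h0 : ∀ a b, ∫ t in Set.Icc 0 u, ψ (a * t + b) • h t = 0) :
    ∀ᵐ t ∂volume.restrict (Set.Icc 0 u), h t = 0 := by
  have hψ := locallyIntegrable_of_locally_ae_bounded hm hb
  refine ae_eq_zero_of_integral_pow_smul_eq_zero u h hh fun k ↦ ?_
  by_contra hk
  obtain ⟨p, hp'⟩ := exists_polynomial_ae_eq_of_iteratedDeriv_convolution_eq_zero k ψ hψ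
    fun φ b ↦ by
      have := integral_iteratedDeriv_smul_eq_zero u h hh _
        (φ.hasCompactSupport_normed.contDiff_convolution_left (n := ⊤)
          (ContinuousLinearMap.lsmul ℝ ℝ) φ.contDiff_normed hψ) b
        (fun a ↦ integral_convolution_smul_eq_zero hm hb u h hh h0 _
          (φ.contDiff_normed (μ := volume) (n := 0)).continuous φ.hasCompactSupport_normed a b) k 0
      -- At `a = 0` the derivative no longer depends on `t` and leaves the integral.
      simp only [zero_mul, zero_add, integral_smul] at this
      exact (smul_eq_zero.1 this).resolve_right hk
  exact hp p hp'

/-! ### Density of networks in `L²` -/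

theorem memLp_activation {ψ : ℝ → ℝ} (hm : AEStronglyMeasurable ψ volume)
    (hb : ∀ K : Set ℝ, IsCompact K → ∃ C, ∀ᵐ x ∂(volume.restrict K), |ψ x| ≤ C)
    (u : ℝ) (p : ℝ≥0∞) (a b : ℝ) : MemLp (fun t ↦ ψ (a * t + b)) p (timeMeasure u) := by
  -- For `a = 0` the affine map does not pull null sets back to null sets, but the function is
  -- constant.
  rcases eq_or_ne a 0 with rfl | ha
  · simpa using memLp_const _
  have hq : Measure.QuasiMeasurePreserving (fun t : ℝ ↦ a * t + b) volume volume := by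
    refine (measurePreserving_add_right volume b).quasiMeasurePreserving.comp
      (g := (· + b)) (f := (a * ·)) ⟨by fun_prop, ?_⟩
    rw [Real.map_volume_mul_left ha]
    exact Measure.smul_absolutelyContinuous
  have hK : IsCompact ((fun t : ℝ ↦ a * t + b) '' Set.Icc 0 u) :=
    isCompact_Icc.image (by fun_prop)
  obtain ⟨C, hC⟩ := hb _ hK
  rw [ae_restrict_iff' hK.measurableSet] at hC
  refine MemLp.of_bound (hm.comp_quasiMeasurePreserving hq).restrict C ?_
  rw [ae_restrict_iff' measurableSet_Icc]
  filter_upwards [hq.ae hC] with t h1 ht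
  exact h1 ⟨t, ht, rfl⟩

theorem memLp_of_mem_shallowNetworks {d : ℕ} {ψ : ℝ → ℝ} (hm : AEStronglyMeasurable ψ volume)
    (hb : ∀ K : Set ℝ, IsCompact K → ∃ C, ∀ᵐ x ∂(volume.restrict K), |ψ x| ≤ C)
    (u : ℝ) (p : ℝ≥0∞) {g : ℝ → EuclideanSpace ℝ (Fin d)} (hg : g ∈ shallowNetworks d ψ) :
    MemLp g p (timeMeasure u) := by
  obtain ⟨N, a, b, w, h⟩ := hg
  rw [funext h]
  exact memLp_finsetSum _ fun j _ ↦
    (ContinuousLinearMap.toSpanSingleton ℝ (w j)).comp_memLp' (memLp_activation hm hb u p _ _)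

/-- Shallow networks are dense in `L²`. -/
theorem exists_mem_shallowNetworks_eLpNorm_sub_le {d : ℕ} {ψ : ℝ → ℝ}
    (hm : AEStronglyMeasurable ψ volume)
    (hb : ∀ K : Set ℝ, IsCompact K → ∃ C, ∀ᵐ x ∂(volume.restrict K), |ψ x| ≤ C)
    (hp : ∀ p : Polynomial ℝ, ¬ ∀ᵐ x ∂(volume : Measure ℝ), ψ x = p.eval x)
    (u : ℝ) (G : ℝ → EuclideanSpace ℝ (Fin d)) (hG : MemLp G 2 (timeMeasure u))
    {ε : ℝ≥0∞} (hε : ε ≠ 0) :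
    ∃ g ∈ shallowNetworks d ψ, eLpNorm (G - g) 2 (timeMeasure u) ≤ ε := by
  let S : Set (Lp (EuclideanSpace ℝ (Fin d)) 2 (timeMeasure u)) :=
    {F | ∃ (a b : ℝ) (w : EuclideanSpace ℝ (Fin d)),
      F =ᵐ[timeMeasure u] fun t ↦ ψ (a * t + b) • w}
  have hspan : ∀ F ∈ Submodule.span ℝ S, ∃ g ∈ shallowNetworks d ψ, F =ᵐ[timeMeasure u] g := by
    intro F hF
    induction hF using Submodule.span_induction with
    | mem F hF =>
      obtain ⟨a, b, w, h⟩ := hF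
      exact ⟨_, ⟨1, fun _ ↦ a, fun _ ↦ b, fun _ ↦ w, fun t ↦ by simp⟩, h⟩
    | zero => exact ⟨0, ⟨0, 0, 0, 0, fun t ↦ by simp⟩, Lp.coeFn_zero _ _ _⟩
    | add F F' _ _ ih ih' =>
      obtain ⟨g, ⟨N, a, b, w, hg⟩, h⟩ := ih
      obtain ⟨g', ⟨N', a', b', w', hg'⟩, h'⟩ := ih'
      refine ⟨g + g', ⟨N + N', Fin.append a a', Fin.append b b', Fin.append w w', fun t ↦ ?_⟩, ?_⟩
      · simp [Fin.sum_univ_add, hg, hg']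
      · exact (Lp.coeFn_add F F').trans (h.add h')
    | smul c F _ ih =>
      obtain ⟨g, ⟨N, a, b, w, hg⟩, h⟩ := ih
      refine ⟨c • g, ⟨N, a, b, c • w, fun t ↦ ?_⟩, (Lp.coeFn_smul c F).trans (h.const_smul c)⟩
      simp [hg, Finset.smul_sum, smul_comm c]
  have htop : (Submodule.span ℝ S).topologicalClosure = ⊤ := by
    rw [Submodule.topologicalClosure_eq_top_iff, Submodule.eq_bot_iff]
    intro F hF
    have hFi : MemLp F 2 (timeMeasure u) := Lp.memLp F
    rw [Lp.eq_zero_iff_ae_eq_zero]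
    refine ae_eq_zero_of_integral_activation_smul_eq_zero hm hb hp u F
      (hFi.integrable one_le_two) fun a b ↦ ?_
    have hi : Integrable (fun t ↦ ψ (a * t + b) • F t) (timeMeasure u) :=
      memLp_one_iff_integrable.1 (hFi.smul (memLp_activation hm hb u 2 a b))
    -- The output weights `w` are arbitrary, so scalar orthogonality in `L²` gives a vanishing
    -- vector integral.
    refine ext_inner_left ℝ fun w ↦ ?_
    rw [← integral_inner hi, inner_zero_right]
    have hw : MemLp (fun t ↦ ψ (a * t + b) • w) 2 (timeMeasure u) :=
      (ContinuousLinearMap.toSpanSingleton ℝ w).comp_memLp' (memLp_activation hm hb u 2 a b)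
    have := hF (hw.toLp _) (Submodule.subset_span ⟨a, b, w, hw.coeFn_toLp⟩)
    rw [L2.inner_def] at this
    rw [← this]
    refine integral_congr_ae ?_
    filter_upwards [hw.coeFn_toLp] with t ht
    rw [ht, inner_smul_left, inner_smul_right]
    rfl
  have hmem : hG.toLp G ∈ closure (Submodule.span ℝ S : Set _) := by
    rw [← Submodule.topologicalClosure_coe, htop]; trivial
  obtain ⟨F, hF, hd⟩ := EMetric.mem_closure_iff.1 hmem ε hε.bot_lt
  obtain ⟨g, hg, hFg⟩ := hspan F hF
  refine ⟨g, hg, le_trans (le_of_eq ?_) hd.le⟩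
  rw [Lp.edist_def]
  exact eLpNorm_congr_ae (hG.coeFn_toLp.symm.sub hFg.symm)

/-! ### Admissible activations -/

/-- The bound holds on a dense set, hence everywhere by closedness, and a bounded polynomial is
constant. -/
theorem exists_eval_eq_of_ae_abs_eval_le (p : Polynomial ℝ) (C : ℝ)
    (h : ∀ᵐ x ∂(volume : Measure ℝ), |p.eval x| ≤ C) : ∃ c, ∀ x, p.eval x = c := by
  have hcl : IsClosed {x : ℝ | |p.eval x| ≤ C} :=
    isClosed_le p.continuous.abs continuous_const
  have hall : {x : ℝ | |p.eval x| ≤ C} = Set.univ := by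
    rw [← hcl.closure_eq]; exact (Measure.dense_of_ae h).closure_eq
  have hdeg := (Polynomial.isBoundedUnder_abs_atTop_iff p).1
    (isBoundedUnder_of ⟨C, Set.eq_univ_iff_forall.1 hall⟩)
  exact ⟨p.coeff 0, fun x ↦ by rw [Polynomial.eq_C_of_degree_le_zero hdeg]; simp⟩

/-- The common ground of the three conditions. The first implies the third, since continuous
functions that agree almost everywhere agree; in the second, measurability comes from the null set
of discontinuities. -/
theorem AdmissibleActivation.properties {ψ : ℝ → ℝ} (hψ : AdmissibleActivation ψ) :
    AEStronglyMeasurable ψ volume ∧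
    (∀ K : Set ℝ, IsCompact K → ∃ C, ∀ᵐ x ∂(volume.restrict K), |ψ x| ≤ C) ∧
    ∀ p : Polynomial ℝ, ¬ ∀ᵐ x ∂(volume : Measure ℝ), ψ x = p.eval x := by
  have key : MeasurableBoundedNonconstant ψ → AEStronglyMeasurable ψ volume ∧
      (∀ K : Set ℝ, IsCompact K → ∃ C, ∀ᵐ x ∂(volume.restrict K), |ψ x| ≤ C) ∧
      ∀ p : Polynomial ℝ, ¬ ∀ᵐ x ∂(volume : Measure ℝ), ψ x = p.eval x := by
    rintro ⟨hm, ⟨C, hC⟩, hc⟩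
    refine ⟨hm.aestronglyMeasurable, fun K _ ↦ ⟨C, Eventually.of_forall hC⟩, fun p hp ↦ ?_⟩
    obtain ⟨c, h⟩ := exists_eval_eq_of_ae_abs_eval_le p C (by
      filter_upwards [hp] with x hx
      rw [← hx]; exact hC x)
    exact hc ⟨c, by filter_upwards [hp] with x hx; rw [hx, h]⟩
  rcases hψ with ⟨hcont, hC, hc⟩ | ⟨hb, hp, hd⟩ | h
  · refine key ⟨hcont.measurable, hC, fun ⟨c, h⟩ ↦ hc ⟨c, ?_⟩⟩
    exact congrFun ((hcont.ae_eq_iff_eq volume continuous_const).1 h)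
  · refine ⟨?_, hb, hp⟩
    have hS : MeasurableSet {x | ContinuousAt ψ x} := (IsGδ.setOfPred_continuousAt ψ).measurableSet
    have hon : ContinuousOn ψ {x | ContinuousAt ψ x} := fun x hx ↦ hx.continuousWithinAt
    have := hon.aestronglyMeasurable (μ := volume) hS
    rwa [Measure.restrict_eq_self_of_ae_mem (by exact hd)] at this
  · exact key h

/-! ### Boundedness of `J` from `L²` to the Hölder norm -/

theorem memLambda2_one_of_memLp {d : ℕ} {μ : Measure ℝ} {g : ℝ → EuclideanSpace ℝ (Fin d)}
    (hg : MemLp g 2 μ) : MemLambda2 μ (fun _ ↦ 1) g := by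
  refine ⟨hg.1, ?_⟩
  have h := (memLp_two_iff_integrable_sq_norm hg.1).1 hg
  have h2 : ∀ s, (g s).ofLp ⬝ᵥ (Matrix.mulVec (1 : Matrix (Fin d) (Fin d) ℝ) (g s).ofLp)
      = ‖g s‖ ^ 2 := fun s ↦ by
    rw [Matrix.one_mulVec, EuclideanSpace.norm_sq_eq]
    simp [dotProduct, sq]
  simp_rw [h2]
  exact h.lintegral_lt_top

theorem cameronMartinMap_one_sub {d : ℕ} {u : ℝ} {g : ℝ → EuclideanSpace ℝ (Fin d)}
    (hg : IntegrableOn g (timeSet u)) {s t : ℝ} (hs : s ∈ timeSet u) (ht : t ∈ timeSet u) :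
    cameronMartinMap (timeMeasure u) (fun _ ↦ 1) g t
      - cameronMartinMap (timeMeasure u) (fun _ ↦ 1) g s = ∫ x in s..t, g x := by
  have hJ : ∀ r ∈ timeSet u, cameronMartinMap (timeMeasure u) (fun _ ↦ 1) g r
      = ∫ x in (0 : ℝ)..r, g x := by
    intro r hr
    simp only [cameronMartinMap, Matrix.one_mulVec, WithLp.toLp_ofLp]
    rw [Measure.restrict_restrict measurableSet_Icc,
      Set.inter_eq_left.2 (Set.Icc_subset_Icc_right hr.2), integral_Icc_eq_integral_Ioc,
      intervalIntegral.integral_of_le hr.1]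
  have hi : ∀ r ∈ timeSet u, IntervalIntegrable g volume 0 r := fun r hr ↦
    (intervalIntegrable_iff_integrableOn_Icc_of_le hr.1).2
      (hg.mono_set (Set.Icc_subset_Icc_right hr.2))
  rw [hJ t ht, hJ s hs, intervalIntegral.integral_interval_sub_left (hi t ht) (hi s hs)]

theorem enorm_integral_le_eLpNorm_two {d : ℕ} {u : ℝ} {g : ℝ → EuclideanSpace ℝ (Fin d)}
    (hg : MemLp g 2 (timeMeasure u)) {s t : ℝ} (hs : s ∈ timeSet u) (ht : t ∈ timeSet u)
    (hst : s ≤ t) :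
    ‖∫ x in s..t, g x‖ₑ ≤ eLpNorm g 2 (timeMeasure u) * ENNReal.ofReal (t - s) ^ (1 / 2 : ℝ) := by
  have hsub : Set.Ioc s t ⊆ timeSet u := fun x hx ↦ ⟨hs.1.trans hx.1.le, hx.2.trans ht.2⟩
  have hle : volume.restrict (Set.Ioc s t) ≤ timeMeasure u := Measure.restrict_mono hsub le_rfl
  rw [intervalIntegral.integral_of_le hst]
  calc _ ≤ eLpNorm g 1 (volume.restrict (Set.Ioc s t)) := by
        rw [eLpNorm_one_eq_lintegral_enorm]; exact enorm_integral_le_lintegral_enorm _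
    _ ≤ _ := eLpNorm_le_eLpNorm_mul_rpow_measure_univ one_le_two (hg.1.mono_measure hle)
    _ ≤ _ := by
        rw [Measure.restrict_apply_univ, Real.volume_Ioc]
        norm_num
        gcongr

theorem holderENorm_le_iff {d : ℕ} {u : ℝ} {α : ℝ≥0} {f : ℝ → EuclideanSpace ℝ (Fin d)}
    {ε : ℝ≥0∞} : holderENorm u α f ≤ ε ↔ ∀ s ∈ timeSet u, ∀ t ∈ timeSet u, 0 < t - s → t - s ≤ 1 →
      ENNReal.ofReal (‖f t - f s‖ / (t - s) ^ (α : ℝ)) ≤ ε := by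
  simp only [holderENorm, iSup_le_iff, and_imp]

/-- The restriction `t - s ≤ 1` gives `(t - s)^(1/2) ≤ (t - s)^α`. -/
theorem enorm_integral_div_rpow_le {d : ℕ} {u : ℝ} {α : ℝ≥0} (hα : (α : ℝ) < 1 / 2)
    {g : ℝ → EuclideanSpace ℝ (Fin d)} (hg : MemLp g 2 (timeMeasure u)) {s t : ℝ}
    (hs : s ∈ timeSet u) (ht : t ∈ timeSet u) (h0 : 0 < t - s) (h1 : t - s ≤ 1) :
    ENNReal.ofReal (‖∫ x in s..t, g x‖ / (t - s) ^ (α : ℝ)) ≤ eLpNorm g 2 (timeMeasure u) := by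
  rw [ENNReal.ofReal_div_of_pos (by positivity), ofReal_norm]
  refine ENNReal.div_le_of_le_mul ?_
  refine (enorm_integral_le_eLpNorm_two hg hs ht (by linarith)).trans ?_
  gcongr
  rw [ENNReal.ofReal_rpow_of_pos h0]
  exact ENNReal.ofReal_le_ofReal (Real.rpow_le_rpow_of_exponent_ge h0 h1 hα.le)

/-! ### Little Hölder functions and Steklov averages -/

/-- The uniform little-o condition in the definition of the little Hölder space. -/
def UniformLittleHolder {d : ℕ} (u : ℝ) (α : ℝ≥0) (f : ℝ → EuclideanSpace ℝ (Fin d)) : Prop :=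
  ∀ ε > 0, ∃ δ > 0, ∀ s ∈ timeSet u, ∀ t ∈ timeSet u, |t - s| < δ →
    ‖f t - f s‖ ≤ ε * |t - s| ^ (α : ℝ)

theorem UniformLittleHolder.of_holderOnWith {d : ℕ} {u : ℝ} {α β C : ℝ≥0} (hβα : β < α)
    {f : ℝ → EuclideanSpace ℝ (Fin d)} (hf : HolderOnWith C α f (timeSet u)) :
    UniformLittleHolder u β f := by
  intro ε hε
  have hγ : 0 < (α : ℝ) - β := sub_pos.2 (by exact_mod_cast hβα)
  -- This `δ` solves `(C + 1) δ^(α - β) = ε`; the `+ 1` covers `C = 0`.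
  refine ⟨(ε / (C + 1)) ^ (1 / ((α : ℝ) - β)), by positivity, fun s hs t ht hst ↦ ?_⟩
  rcases eq_or_ne t s with rfl | hne
  · simp only [sub_self, norm_zero]; positivity
  have hpos : 0 < |t - s| := abs_pos.2 (sub_ne_zero.2 hne)
  have h1 := hf.dist_le ht hs
  rw [dist_eq_norm, Real.dist_eq] at h1
  have h2 : |t - s| ^ ((α : ℝ) - β) ≤ ε / (C + 1) := by
    calc _ ≤ ((ε / (C + 1)) ^ (1 / ((α : ℝ) - β))) ^ ((α : ℝ) - β) :=
          Real.rpow_le_rpow hpos.le hst.le hγ.le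
      _ = _ := by
          rw [← Real.rpow_mul (by positivity), one_div_mul_cancel hγ.ne', Real.rpow_one]
  calc _ ≤ (C : ℝ) * |t - s| ^ (α : ℝ) := h1
    _ = C * |t - s| ^ ((α : ℝ) - β) * |t - s| ^ (β : ℝ) := by
        rw [mul_assoc, ← Real.rpow_add hpos, sub_add_cancel]
    _ ≤ (C + 1) * (ε / (C + 1)) * |t - s| ^ (β : ℝ) := by gcongr; linarith
    _ = _ := by field_simp

/-- Differences of Steklov averages approximate the function in the Hölder norm. -/
theorem exists_continuous_integral_holder_close {d : ℕ} {u : ℝ} (hu : 0 < u) {α : ℝ≥0}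
    {f : ℝ → EuclideanSpace ℝ (Fin d)} (hc : ContinuousOn f (timeSet u))
    (hf : UniformLittleHolder u α f) {ε : ℝ} (hε : 0 < ε) :
    ∃ G : ℝ → EuclideanSpace ℝ (Fin d), Continuous G ∧ ∀ s ∈ timeSet u, ∀ t ∈ timeSet u, s < t →
      ‖f t - f s - ∫ x in s..t, G x‖ ≤ ε * (t - s) ^ (α : ℝ) := by
  -- Constant extension beyond the endpoints makes shifts of `f` meaningful; the projection is
  -- 1-Lipschitz, so the little-o bound survives.
  set F : ℝ → EuclideanSpace ℝ (Fin d) := fun x ↦ f (Set.projIcc 0 u hu.le x) with hF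
  have hFc : Continuous F :=
    (continuousOn_iff_continuous_domRestrict.1 hc).comp continuous_projIcc
  have hFf : ∀ x ∈ timeSet u, F x = f x := fun x hx ↦ by
    simp only [hF, Set.projIcc_of_mem hu.le hx]
  obtain ⟨δ, hδ, h⟩ := hf (ε / 2) (by positivity)
  have hFδ : ∀ x y, |x - y| < δ → ‖F x - F y‖ ≤ ε / 2 * |x - y| ^ (α : ℝ) := by
    intro x y hxy
    have hp : |(Set.projIcc 0 u hu.le x : ℝ) - Set.projIcc 0 u hu.le y| ≤ |x - y| :=
      Set.abs_projIcc_sub_projIcc hu.le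
    refine (h _ (Subtype.mem _) _ (Subtype.mem _) (hp.trans_lt hxy)).trans ?_
    gcongr
  have hη : 0 < δ / 2 := by positivity
  refine ⟨fun x ↦ (δ / 2)⁻¹ • (F (x + δ / 2) - F x), by fun_prop, fun s hs t ht hst ↦ ?_⟩
  have hi : ∀ a b, IntervalIntegrable F volume a b := fun a b ↦ hFc.intervalIntegrable a b
  -- The error is the mean over shifts `r ∈ [0, δ / 2]` of a second difference of `F`.
  have hD : f t - f s - ∫ x in s..t, (δ / 2)⁻¹ • (F (x + δ / 2) - F x)
      = (δ / 2)⁻¹ • ∫ r in (0 : ℝ)..(δ / 2), ((F t - F s) - (F (t + r) - F (s + r))) := by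
    have e1 : ∫ x in s..t, F (x + δ / 2) = ∫ x in (s + δ / 2)..(t + δ / 2), F x :=
      intervalIntegral.integral_comp_add_right _ _
    have e2 : ∀ c, ∫ r in (0 : ℝ)..(δ / 2), F (c + r) = ∫ x in c..(c + δ / 2), F x := fun c ↦ by
      rw [intervalIntegral.integral_comp_add_left, add_zero]
    have hI : ∀ g : ℝ → EuclideanSpace ℝ (Fin d), Continuous g → ∀ a b,
      IntervalIntegrable g volume a b := fun g hg a b ↦ hg.intervalIntegrable a b
    rw [intervalIntegral.integral_smul, intervalIntegral.integral_sub (hI _ (by fun_prop) _ _)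
      (hI _ (by fun_prop) _ _), intervalIntegral.integral_sub (hI _ (by fun_prop) _ _)
      (hI _ (by fun_prop) _ _), intervalIntegral.integral_sub (hI _ (by fun_prop) _ _)
      (hI _ (by fun_prop) _ _), intervalIntegral.integral_sub (hI _ (by fun_prop) _ _)
      (hI _ (by fun_prop) _ _), e1, e2, e2, intervalIntegral.integral_const,
      intervalIntegral.integral_const, sub_zero, ← hFf t ht, ← hFf s hs,
      intervalIntegral.integral_interval_sub_interval_comm' (hi _ _) (hi _ _) (hi _ _),
      ← smul_sub, smul_sub _ ((δ / 2) • (F t - F s)), inv_smul_smul₀ hη.ne']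
  rw [hD, norm_smul, norm_inv, Real.norm_of_nonneg hη.le]
  have hts : 0 < t - s := sub_pos.2 hst
  have hbound : ∀ r ∈ Set.uIoc 0 (δ / 2),
      ‖(F t - F s) - (F (t + r) - F (s + r))‖ ≤ ε * (t - s) ^ (α : ℝ) := by
    intro r hr
    rw [Set.uIoc_of_le hη.le] at hr
    -- The second difference is grouped by increments of length `t - s` if this is below `δ`, and
    -- otherwise by increments of length `r < δ ≤ t - s`.
    rcases lt_or_ge (t - s) δ with hlt | hge
    · have h1 := hFδ t s (by rwa [abs_of_pos hts])
      have h2 := hFδ (t + r) (s + r) (by rwa [add_sub_add_right_eq_sub, abs_of_pos hts])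
      rw [add_sub_add_right_eq_sub] at h2
      rw [abs_of_pos hts] at h1 h2
      linarith [norm_sub_le (F t - F s) (F (t + r) - F (s + r))]
    · have hb : ∀ c, ‖F c - F (c + r)‖ ≤ ε / 2 * (t - s) ^ (α : ℝ) := fun c ↦ by
        have hr' : |c - (c + r)| = r := by
          rw [sub_add_cancel_left, abs_neg, abs_of_pos hr.1]
        refine (hFδ c (c + r) (by rw [hr']; linarith [hr.2])).trans ?_
        rw [hr']
        have := hr.1.le
        gcongr
        linarith [hr.2]
      rw [sub_sub_sub_comm]
      linarith [norm_sub_le (F t - F (t + r)) (F s - F (s + r)), hb t, hb s]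
  have := intervalIntegral.norm_integral_le_of_norm_le_const hbound
  rw [sub_zero, abs_of_pos hη] at this
  calc _ ≤ (δ / 2)⁻¹ * (ε * (t - s) ^ (α : ℝ) * (δ / 2)) := by gcongr
    _ = _ := by field_simp

/-! ### Combining the two approximations -/

theorem approximableByNetworks_of_uniformLittleHolder {d : ℕ} {u : ℝ} (hu : 0 < u) {α : ℝ≥0}
    (hα : (α : ℝ) < 1 / 2) {ψ : ℝ → ℝ} (hψ : AdmissibleActivation ψ)
    {f : ℝ → EuclideanSpace ℝ (Fin d)} (hc : ContinuousOn f (timeSet u))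
    (hf : UniformLittleHolder u α f) : ApproximableByNetworks u ψ α f := by
  obtain ⟨hm, hb, hp⟩ := hψ.properties
  have key : ∀ n : ℕ, ∃ g ∈ shallowNetworks d ψ, holderENorm u α
      (fun t => f t - cameronMartinMap (timeMeasure u) (fun _ => 1) g t)
      ≤ ENNReal.ofReal (2 * (1 / ((n : ℝ) + 1))) := by
    intro n
    have hε : 0 < 1 / ((n : ℝ) + 1) := by positivity
    set ε := 1 / ((n : ℝ) + 1)
    obtain ⟨G, hG, hGf⟩ := exists_continuous_integral_holder_close hu hc hf hε
    have hGL : MemLp G 2 (timeMeasure u) :=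
      let ⟨C, hC⟩ := isCompact_Icc.exists_bound_of_continuousOn hG.continuousOn
      MemLp.of_bound hG.aestronglyMeasurable C (ae_restrict_of_forall_mem measurableSet_Icc hC)
    obtain ⟨g, hg, hgG⟩ := exists_mem_shallowNetworks_eLpNorm_sub_le hm hb hp u G hGL
      (ENNReal.ofReal_pos.2 hε).ne'
    refine ⟨g, hg, holderENorm_le_iff.2 fun s hs t ht h0 h1 ↦ ?_⟩
    have hgL : MemLp g 2 (timeMeasure u) := memLp_of_mem_shallowNetworks hm hb u 2 hg
    have hiv : ∀ H : ℝ → EuclideanSpace ℝ (Fin d), MemLp H 2 (timeMeasure u) →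
        IntervalIntegrable H volume s t := fun H hH ↦
      (intervalIntegrable_iff_integrableOn_Icc_of_le (by linarith)).2
        (IntegrableOn.mono_set (hH.integrable one_le_two) (Set.Icc_subset_Icc hs.1 ht.2))
    have hpos : 0 < (t - s) ^ (α : ℝ) := by positivity
    have hsplit : (f t - cameronMartinMap (timeMeasure u) (fun _ => 1) g t) -
        (f s - cameronMartinMap (timeMeasure u) (fun _ => 1) g s)
        = (f t - f s - ∫ x in s..t, G x) + ∫ x in s..t, (G - g) x := by
      rw [sub_sub_sub_comm, cameronMartinMap_one_sub (hgL.integrable one_le_two) hs ht]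
      simp only [Pi.sub_apply]
      rw [intervalIntegral.integral_sub (hiv G hGL) (hiv g hgL)]
      abel
    rw [hsplit]
    calc _ ≤ ENNReal.ofReal (‖f t - f s - ∫ x in s..t, G x‖ / (t - s) ^ (α : ℝ)
            + ‖∫ x in s..t, (G - g) x‖ / (t - s) ^ (α : ℝ)) := by
          rw [← add_div]
          gcongr
          exact norm_add_le _ _
      _ = ENNReal.ofReal (‖f t - f s - ∫ x in s..t, G x‖ / (t - s) ^ (α : ℝ))
            + ENNReal.ofReal (‖∫ x in s..t, (G - g) x‖ / (t - s) ^ (α : ℝ)) :=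
          ENNReal.ofReal_add (by positivity) (by positivity)
      _ ≤ ENNReal.ofReal ε + ENNReal.ofReal ε := by
          refine add_le_add (ENNReal.ofReal_le_ofReal ?_) ?_
          · rw [div_le_iff₀ hpos]
            exact hGf s hs t ht (by linarith)
          · exact (enorm_integral_div_rpow_le hα (hGL.sub hgL) hs ht h0 h1).trans hgG
      _ = _ := by rw [← ENNReal.ofReal_add hε.le hε.le, two_mul]
  choose g hg hgε using key
  refine ⟨g, fun n ↦ ⟨hg n, memLambda2_one_of_memLp
    (memLp_of_mem_shallowNetworks hm hb u 2 (hg n))⟩, ?_⟩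
  refine tendsto_of_tendsto_of_tendsto_of_le_of_le tendsto_const_nhds ?_
    (fun _ ↦ zero_le) hgε
  have := ENNReal.tendsto_ofReal ((tendsto_one_div_add_atTop_nhds_zero_nat (𝕜 := ℝ)).const_mul 2)
  simpa using this

theorem mainTheorem7 (d : ℕ) (u : ℝ) (hu : 0 < u) (α β : ℝ≥0)
    (hβ : 0 < β) (hβα : β < α) (hα : (α : ℝ) < 1 / 2)
    (ψ : ℝ → ℝ) (hψ : AdmissibleActivation ψ) :
    (∀ f : ℝ → EuclideanSpace ℝ (Fin d), MemLittleHolderSpace u α f →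
      ApproximableByNetworks u ψ α f) ∧
    (∀ f : ℝ → EuclideanSpace ℝ (Fin d), MemSmoothSpace u f →
      ApproximableByNetworks u ψ α f) ∧
    (∀ f : ℝ → EuclideanSpace ℝ (Fin d), MemHolderSpace u α f →
      ApproximableByNetworks u ψ β f) := by
  have hβα' : (β : ℝ) < α := by exact_mod_cast hβα
  refine ⟨fun f hf ↦ ?_, fun f hf ↦ ?_, fun f hf ↦ ?_⟩
  · obtain ⟨⟨-, C, hC⟩, ho⟩ := hf
    exact approximableByNetworks_of_uniformLittleHolder hu hα hψ
      (hC.continuousOn (hβ.trans hβα)) ho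
  -- Smooth functions on the compact interval are Lipschitz, that is, Hölder with exponent `1 > α`.
  · obtain ⟨C, hC⟩ := (hf.2.of_le (m := 1) (by exact_mod_cast le_top)).exists_lipschitzOnWith
      one_ne_zero (convex_Icc 0 u) isCompact_Icc
    refine approximableByNetworks_of_uniformLittleHolder hu hα hψ hf.2.continuousOn
      (UniformLittleHolder.of_holderOnWith (α := 1) (C := C) ?_ (holderOnWith_one.2 hC))
    rw [← NNReal.coe_lt_coe, NNReal.coe_one]
    linarith
  · obtain ⟨-, C, hC⟩ := hf
    exact approximableByNetworks_of_uniformLittleHolder hu (hβα'.trans hα) hψ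
      (hC.continuousOn (hβ.trans hβα)) (UniformLittleHolder.of_holderOnWith hβα hC)
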